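/- Work over $\mathbb{C}$. Let $k\ge 2$ and $V=\mathbb{C}^k$, and regard $k$-dimensional (not necessarily associative) algebras as points $\mu$ of the affine space $\mathrm{Hom}(V\otimes V,V)\cong\mathbb{C}^{k^3}$, with structure constants as coordinates. The group $GL(V)$ acts by $(g*\mu)(x\otimes y)=g\,\mu(g^{-1}x\otimes g^{-1}y)$, and $O(\mu)$ denotes the orbit of $\mu$. An algebra $\mu$ \emph{degenerates} to $\lambda$, written $\mu\to\lambda$, if $\lambda$ lies in the Zariski closure $\overline{O(\mu)}$; the degeneration is \emph{proper} if $\mu\not\cong\lambda$. A Jordan algebra is a commutative algebra satisfying $(x^2y)x=x^2(yx)$. The \emph{level} of a Jordan algebra $\mu$ is the maximal length $m$ of a chain $\mu=\mu_0\to\mu_1\to\dots\to\mu_m$ of proper degenerations of $k$-dimensional Jordan algebras. Let $\mathfrak{J}_k$ be the $k$-dimensional Jordan algebra with basis $e,n_1,\dots,n_{k-1}$ and multiplication $e^2=e$, $en_i=n_ie=\tfrac12 n_i$, $n_in_j=0$ for $i,j=1,\dots,k-1$. If $\mathfrak{J}_k\to\mathfrak{J}'$ is a proper degeneration, where $\mathfrak{J}'$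 is an algebra of dimension $k$, then $\mathfrak{J}'$ has zero multiplication. Moreover, $\mathfrak{J}_k$ has level one. -/

import Mathlib

namespace MargDeg

/-- The affine space `Hom(V ⊗ V, V)` for `V = ℂⁿ`: a point of it is an `n`-dimensional complex
algebra, not necessarily associative, commutative or unital, given by its bilinear
multiplication. -/
abbrev Alg (n : ℕ) : Type :=
  (Fin n → ℂ) →ₗ[ℂ] (Fin n → ℂ) →ₗ[ℂ] (Fin n → ℂ)

/-- The structure constants `c_{i,j}^l` of `μ`, defined by `μ(e_i, e_j) = ∑ l, c_{i,j}^l e_l`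
where `e_1, …, e_n` is the standard basis. -/
def structConst {n : ℕ} (μ : Alg n) : Fin n × Fin n × Fin n → ℂ :=
  fun p => μ (Pi.single p.1 1) (Pi.single p.2.1 1) p.2.2

/-- A set of multiplications is Zariski closed if it is the set of solutions of a family of
polynomial equations in the structure constants. -/
def IsZariskiClosed {n : ℕ} (S : Set (Alg n)) : Prop :=
  ∃ P : Set (MvPolynomial (Fin n × Fin n × Fin n) ℂ),
    S = {μ | ∀ p ∈ P, MvPolynomial.eval (structConst μ) p = 0}

/-- The Zariski closure: the intersection of all Zariski closed sets containing `S`. -/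
def zariskiClosure {n : ℕ} (S : Set (Alg n)) : Set (Alg n) :=
  ⋂₀ {T | IsZariskiClosed T ∧ S ⊆ T}

/-- The action of `GL(V)`: `(g * μ)(x, y) = g (μ (g⁻¹ x, g⁻¹ y))`. -/
def act {n : ℕ} (g : (Fin n → ℂ) ≃ₗ[ℂ] (Fin n → ℂ)) (μ : Alg n) : Alg n :=
  (μ.compl₁₂ g.symm.toLinearMap g.symm.toLinearMap).compr₂ g.toLinearMap

theorem act_apply {n : ℕ} (g : (Fin n → ℂ) ≃ₗ[ℂ] (Fin n → ℂ)) (μ : Alg n) (x y : Fin n → ℂ) :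
    act g μ x y = g (μ (g.symm x) (g.symm y)) := rfl

/-- The `GL(V)`-orbit `O(μ)`. -/
def orbit {n : ℕ} (μ : Alg n) : Set (Alg n) :=
  Set.range fun g : (Fin n → ℂ) ≃ₗ[ℂ] (Fin n → ℂ) => act g μ

/-- Isomorphism of algebras. -/
def Isomorphic {n : ℕ} (μ ν : Alg n) : Prop :=
  ∃ g : (Fin n → ℂ) ≃ₗ[ℂ] (Fin n → ℂ), ∀ x y, g (μ x y) = ν (g x) (g y)

/-- `μ` degenerates to `ν` (`μ → ν`): `ν` lies in the Zariski closure of the orbit of `μ`. -/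
def Degenerates {n : ℕ} (μ ν : Alg n) : Prop :=
  ν ∈ zariskiClosure (orbit μ)

/-- A degeneration between non-isomorphic algebras. -/
def ProperlyDegenerates {n : ℕ} (μ ν : Alg n) : Prop :=
  Degenerates μ ν ∧ ¬ Isomorphic μ ν

/-- The set of `n`-dimensional Jordan algebras: commutative, with `(x² y) x = x² (y x)`. -/
def Jord (n : ℕ) : Set (Alg n) :=
  {μ | (∀ x y, μ x y = μ y x) ∧ ∀ x y, μ (μ (μ x x) y) x = μ (μ x x) (μ y x)}

/-- There is a chain `μ = c₀ → c₁ → ⋯ → c_m` of `m` proper degenerations of Jordan algebras. -/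
def HasChain {n : ℕ} (μ : Alg n) (m : ℕ) : Prop :=
  ∃ c : Fin (m + 1) → Alg n, c 0 = μ ∧ (∀ i, c i ∈ Jord n) ∧
    ∀ i : Fin m, ProperlyDegenerates (c i.castSucc) (c i.succ)

/-- `μ` has level `m`: the maximal length of a chain of proper degenerations of Jordan algebras
starting with `μ` exists and equals `m`. -/
def HasLevel {n : ℕ} (μ : Alg n) (m : ℕ) : Prop :=
  IsGreatest {l | HasChain μ l} m

/-- The products of the basis vectors `e, n_1, …, n_{k-1}` (the standard basis of `ℂᵏ`, the
vector `e` being the first one): `e e = e`, `e n_i = n_i e = n_i / 2`, `n_i n_j = 0`. -/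
noncomputable def marginalTable (k : ℕ) (i j : Fin k) : Fin k → ℂ :=
  if (i : ℕ) = 0 ∧ (j : ℕ) = 0 then Pi.single i 1
  else if (i : ℕ) = 0 then (1 / 2 : ℂ) • Pi.single j 1
  else if (j : ℕ) = 0 then (1 / 2 : ℂ) • Pi.single i 1
  else 0

/-- The algebra `𝔍_k`: the bilinear extension of the multiplication table. -/
noncomputable def marginal (k : ℕ) : Alg k :=
  (Pi.basisFun ℂ (Fin k)).constr ℂ fun i =>
    (Pi.basisFun ℂ (Fin k)).constr ℂ fun j => marginalTable k i j

theorem marginal_single (k : ℕ) (i j : Fin k) :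
    marginal k (Pi.single i 1) (Pi.single j 1) = marginalTable k i j := by
  rw [← Pi.basisFun_apply ℂ (Fin k) i, ← Pi.basisFun_apply ℂ (Fin k) j, marginal,
    Module.Basis.constr_basis, Module.Basis.constr_basis]

end MargDeg

namespace MargDeg

/-! The product of 𝔍_k is (f(x)y + f(y)x)/2 with f the first coordinate. Letting f range over all
linear functionals gives a GL-stable family which is Zariski closed, and GL is transitive on nonzero
f. So a degeneration of 𝔍_k is either isomorphic to it (f ≠ 0) or zero (f = 0). Scaling shows that 0
is indeed reached, and 0 degenerates only to itself, so the level is one. -/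

variable {n : ℕ}

/-- The algebra `x y = (f x • y + f y • x) / 2` attached to a linear functional `f`. -/
noncomputable def functionalAlg (f : (Fin n → ℂ) →ₗ[ℂ] ℂ) : Alg n :=
  LinearMap.mk₂ ℂ (fun x y => (1 / 2 : ℂ) • (f x • y + f y • x))
    (fun x x' y => by simp only [map_add]; module)
    (fun c x y => by simp only [map_smul, smul_eq_mul]; module)
    (fun x y y' => by simp only [map_add]; module)
    (fun c x y => by simp only [map_smul, smul_eq_mul]; module)

theorem functionalAlg_apply (f : (Fin n → ℂ) →ₗ[ℂ] ℂ) (x y : Fin n → ℂ) :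
    functionalAlg f x y = (1 / 2 : ℂ) • (f x • y + f y • x) := rfl

theorem alg_ext_structConst {μ ν : Alg n} (h : structConst μ = structConst ν) : μ = ν := by
  refine (Pi.basisFun ℂ (Fin n)).ext fun i => (Pi.basisFun ℂ (Fin n)).ext fun j => ?_
  rw [Pi.basisFun_apply, Pi.basisFun_apply]
  funext l
  exact congrFun h (i, j, l)

theorem structConst_functionalAlg (f : (Fin n → ℂ) →ₗ[ℂ] ℂ) (i j l : Fin n) :
    structConst (functionalAlg f) (i, j, l) =
      (1 / 2 : ℂ) * (f (Pi.single i 1) * (if l = j then 1 else 0) +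
        f (Pi.single j 1) * (if l = i then 1 else 0)) := by
  simp [structConst, functionalAlg_apply, Pi.single_apply]

theorem marginal_eq_functionalAlg {k : ℕ} (hk : 0 < k) :
    marginal k = functionalAlg (LinearMap.proj ⟨0, hk⟩) := by
  refine alg_ext_structConst ?_
  funext ⟨i, j, l⟩
  rw [structConst_functionalAlg]
  simp only [structConst, marginal_single, marginalTable, LinearMap.proj_apply, Pi.single_apply]
  by_cases hi : (i : ℕ) = 0
  · by_cases hj : (j : ℕ) = 0
    · obtain rfl : i = ⟨0, hk⟩ := Fin.ext hi
      obtain rfl : j = ⟨0, hk⟩ := Fin.ext hj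
      simp only [and_self, if_true, Pi.single_apply]
      split_ifs <;> norm_num
    · obtain rfl : i = ⟨0, hk⟩ := Fin.ext hi
      have hj' : (⟨0, hk⟩ : Fin k) ≠ j := fun h => hj (by rw [← h])
      simp [hj, hj', Pi.single_apply]
  · have hi' : (⟨0, hk⟩ : Fin k) ≠ i := fun h => hi (by rw [← h])
    by_cases hj : (j : ℕ) = 0
    · obtain rfl : j = ⟨0, hk⟩ := Fin.ext hj
      simp [hi, hi', Pi.single_apply]
    · have hj' : (⟨0, hk⟩ : Fin k) ≠ j := fun h => hj (by rw [← h])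
      simp [hi, hj, hi', hj']

theorem act_functionalAlg (g : (Fin n → ℂ) ≃ₗ[ℂ] (Fin n → ℂ)) (f : (Fin n → ℂ) →ₗ[ℂ] ℂ) :
    act g (functionalAlg f) = functionalAlg (f ∘ₗ g.symm.toLinearMap) := by
  refine LinearMap.ext₂ fun x y => ?_
  simp [act_apply, functionalAlg_apply]

/-- The diagonal constants recover the functional, c_{i,i}^i = f(e_i), so membership amounts to
linear equations expressing every constant through these. -/
theorem isZariskiClosed_range_functionalAlg :
    IsZariskiClosed (Set.range (functionalAlg (n := n))) := by
  refine ⟨Set.range fun p : Fin n × Fin n × Fin n =>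
    MvPolynomial.X p - MvPolynomial.C (1 / 2) *
      (MvPolynomial.X (p.1, p.1, p.1) * MvPolynomial.C (if p.2.2 = p.2.1 then 1 else 0) +
        MvPolynomial.X (p.2.1, p.2.1, p.2.1) * MvPolynomial.C (if p.2.2 = p.1 then 1 else 0)), ?_⟩
  ext μ
  rw [Set.mem_ofPred_eq, Set.forall_mem_range]
  simp only [Set.mem_range, map_sub, map_mul, map_add, MvPolynomial.eval_X,
    MvPolynomial.eval_C, sub_eq_zero]
  constructor
  · rintro ⟨f, rfl⟩ ⟨i, j, l⟩
    simp only [structConst_functionalAlg, if_true]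
    ring
  · intro h
    refine ⟨(Pi.basisFun ℂ (Fin n)).constr ℂ fun i => structConst μ (i, i, i),
      alg_ext_structConst ?_⟩
    funext ⟨i, j, l⟩
    rw [structConst_functionalAlg, h (i, j, l), ← Pi.basisFun_apply, ← Pi.basisFun_apply,
      Module.Basis.constr_basis, Module.Basis.constr_basis]

theorem isZariskiClosed_singleton (μ : Alg n) : IsZariskiClosed {μ} := by
  refine ⟨Set.range fun p => MvPolynomial.X p - MvPolynomial.C (structConst μ p), ?_⟩
  ext ν
  rw [Set.mem_ofPred_eq, Set.forall_mem_range]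
  simp only [Set.mem_singleton_iff, map_sub, MvPolynomial.eval_X,
    MvPolynomial.eval_C, sub_eq_zero]
  exact ⟨fun h p => by rw [h], fun h => alg_ext_structConst (funext h)⟩

theorem mem_of_degenerates {μ ν : Alg n} (h : Degenerates μ ν) {T : Set (Alg n)}
    (hT : IsZariskiClosed T) (hμ : ∀ g, act g μ ∈ T) : ν ∈ T :=
  h T ⟨hT, Set.range_subset_iff.2 hμ⟩

theorem Isomorphic.refl (μ : Alg n) : Isomorphic μ μ :=
  ⟨LinearEquiv.refl ℂ _, fun _ _ => rfl⟩

theorem eq_zero_of_zero_degenerates {ν : Alg n} (h : Degenerates 0 ν) : ν = 0 :=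
  mem_of_degenerates h (isZariskiClosed_singleton 0) fun g => by
    refine LinearMap.ext₂ fun x y => ?_
    simp [act_apply]

theorem smul_mem_orbit (μ : Alg n) {t : ℂ} (ht : t ≠ 0) : t • μ ∈ orbit μ := by
  -- The scalar g = t⁻¹ contributes t⁻¹ from the output and t from each of the two inputs.
  refine ⟨(LinearEquiv.smulOfNeZero ℂ (Fin n → ℂ) t ht).symm, ?_⟩
  refine LinearMap.ext₂ fun x y => ?_
  change act _ μ x y = _
  rw [act_apply, LinearEquiv.symm_apply_eq]
  simp

/-- A polynomial vanishing at t • μ for all t ≠ 0 vanishes at t = 0 by continuity. -/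
theorem degenerates_zero (μ : Alg n) : Degenerates μ 0 := by
  rintro T ⟨⟨P, rfl⟩, hT⟩ p hp
  have hc : Continuous fun t : ℂ => MvPolynomial.eval (t • structConst μ) p :=
    (MvPolynomial.continuous_eval p).comp (continuous_id.smul continuous_const)
  have h := hc.ext_on (dense_compl_singleton (0 : ℂ)) continuous_const (g := fun _ => 0)
    fun t ht => hT (smul_mem_orbit μ ht) p hp
  have h0 := congrFun h 0
  simp only [zero_smul] at h0
  exact h0

/-- The general linear group acts transitively on nonzero linear functionals. -/
theorem exists_linearEquiv_proj_comp_eq (a : Fin n) {f : (Fin n → ℂ) →ₗ[ℂ] ℂ} (hf : f ≠ 0) :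
    ∃ h : (Fin n → ℂ) ≃ₗ[ℂ] (Fin n → ℂ), ∀ x, h x a = f x := by
  obtain ⟨i, hi⟩ : ∃ i, f (Pi.single i 1) ≠ 0 := by
    by_contra! h
    refine hf ((Pi.basisFun ℂ (Fin n)).ext fun i => ?_)
    rw [Pi.basisFun_apply, h i, LinearMap.zero_apply]
  -- Swap coordinates `a` and `i`, then overwrite coordinate `a`, which now holds `x i`, by `f x`. A
  -- kernel vector is a multiple of e_i killed by `f`, hence zero as f(e_i) ≠ 0.
  let h : (Fin n → ℂ) →ₗ[ℂ] (Fin n → ℂ) :=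
    LinearMap.funLeft ℂ ℂ (Equiv.swap a i) +
      LinearMap.single ℂ (fun _ => ℂ) a ∘ₗ (f - LinearMap.proj i)
  have ha : ∀ x, h x a = f x := fun x => by simp [h, LinearMap.funLeft_apply]
  have hinj : Function.Injective h := by
    refine (injective_iff_map_eq_zero h).2 fun x hx => ?_
    have hxj : ∀ j, j ≠ i → x j = 0 := fun j hj => by
      have hne : Equiv.swap a i j ≠ a := fun e => hj (by
        rw [← Equiv.swap_apply_left a i, ← (Equiv.swap_apply_eq_iff.1 e)])
      have := congrFun hx (Equiv.swap a i j)
      simpa [h, LinearMap.funLeft_apply, hne] using this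
    have hxs : x = x i • Pi.single i 1 := by
      funext j
      by_cases hj : j = i
      · subst hj; simp
      · simp [hxj j hj, hj]
    have hfx : f x = 0 := by rw [← ha, hx, Pi.zero_apply]
    rw [hxs, map_smul, smul_eq_mul] at hfx
    rw [hxs, (mul_eq_zero.1 hfx).resolve_right hi, zero_smul]
  exact ⟨LinearEquiv.ofInjectiveEndo h hinj, ha⟩

theorem isomorphic_functionalAlg (a : Fin n) {f : (Fin n → ℂ) →ₗ[ℂ] ℂ} (hf : f ≠ 0) :
    Isomorphic (functionalAlg (LinearMap.proj a)) (functionalAlg f) := by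
  obtain ⟨h, hh⟩ := exists_linearEquiv_proj_comp_eq a hf
  refine ⟨h.symm, fun x y => ?_⟩
  simp [functionalAlg_apply, ← hh]

theorem eq_zero_of_marginal_properlyDegenerates {k : ℕ} (hk : 0 < k) {ν : Alg k}
    (h : ProperlyDegenerates (marginal k) ν) : ν = 0 := by
  rw [marginal_eq_functionalAlg hk] at h
  obtain ⟨f, rfl⟩ := mem_of_degenerates h.1 isZariskiClosed_range_functionalAlg
    fun g => ⟨_, (act_functionalAlg g _).symm⟩
  obtain rfl : f = 0 := by
    by_contra hf
    exact h.2 (isomorphic_functionalAlg _ hf)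
  refine LinearMap.ext₂ fun x y => ?_
  simp [functionalAlg_apply]

/-- Since x² = f(x)x, the Jordan identity reduces to commutativity. -/
theorem functionalAlg_mem_jord (f : (Fin n → ℂ) →ₗ[ℂ] ℂ) : functionalAlg f ∈ Jord n := by
  constructor
  · intro x y
    simp only [functionalAlg_apply, add_comm]
  · intro x y
    simp only [functionalAlg_apply, map_smul, map_add, LinearMap.smul_apply,
      LinearMap.add_apply]
    module

theorem zero_mem_jord : (0 : Alg n) ∈ Jord n := by
  simp [Jord]

theorem not_isomorphic_marginal_zero {k : ℕ} (hk : 0 < k) : ¬ Isomorphic (marginal k) 0 := by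
  rintro ⟨g, hg⟩
  have h := hg (Pi.single ⟨0, hk⟩ 1) (Pi.single ⟨0, hk⟩ 1)
  simp [marginal_single, marginalTable] at h

theorem hasLevel_marginal {k : ℕ} (hk : 0 < k) : HasLevel (marginal k) 1 := by
  constructor
  · refine ⟨![marginal k, 0], rfl, ?_, ?_⟩
    · refine Fin.forall_fin_two.2 ⟨?_, zero_mem_jord⟩
      change marginal k ∈ _
      rw [marginal_eq_functionalAlg hk]
      exact functionalAlg_mem_jord _
    · intro i
      obtain rfl := Subsingleton.elim i 0
      exact ⟨degenerates_zero _, not_isomorphic_marginal_zero hk⟩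
  · rintro m ⟨c, hc0, -, hc⟩
    -- In a chain with at least two steps, the term after 𝔍_k is 0, and 0 has no proper
    -- degeneration.
    by_contra! hm
    have h0 := hc ⟨0, by omega⟩
    have h1 := hc ⟨1, hm⟩
    have e1 : c (Fin.succ ⟨0, by omega⟩) = 0 := by
      refine eq_zero_of_marginal_properlyDegenerates hk ?_
      rw [← hc0]
      exact h0
    have e1' : c (Fin.castSucc ⟨1, hm⟩) = 0 := e1
    rw [e1'] at h1
    apply h1.2
    rw [eq_zero_of_zero_degenerates h1.1]
    exact Isomorphic.refl 0

end MargDeg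

theorem mainTheorem4 (k : ℕ) (hk : 2 ≤ k) :
    (∀ ν : MargDeg.Alg k, MargDeg.ProperlyDegenerates (MargDeg.marginal k) ν →
      ∀ x y : Fin k → ℂ, ν x y = 0) ∧
    MargDeg.HasLevel (MargDeg.marginal k) 1 := by
  have hk0 : 0 < k := by omega
  refine ⟨fun ν h x y => ?_, MargDeg.hasLevel_marginal hk0⟩
  rw [MargDeg.eq_zero_of_marginal_properlyDegenerates hk0 h]
  rfl
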